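/- Conventions. All trees are finite. For a tree $T$, $|T|$ denotes its number of vertices, $V(T)$ its vertex set, and $d(v)$ the degree in $T$ of a vertex $v$. For an integer $k\ge 4$, let $Z_k(T)$ be the number of $k$-element subsets of $V(T)$ that induce a tree, and let $p_1^{(k)}(T)$ (respectively $p_2^{(k)}(T)$) be the number of subsets of $V(T)$ inducing a graph isomorphic to the $k$-vertex path (respectively the $k$-vertex star), divided by $Z_k(T)$; these quotients are defined as soon as $|T|\ge k$. Theorem. Let $T_1,T_2,\ldots$ be a sequence of trees such that $|T_n|\to\infty$ as $n\to\infty$, and let $k,\ell$ be integers with $\ell\ge k\ge 4$. For an integer $m\ge 4$ consider the statements (M1)$_m$ $\displaystyle\lim_{n\to\infty} p_1^{(m)}(T_n)=0$; (M2)$_m$ $\displaystyle\lim_{n\to\infty}\frac1{|T_n|}Z_m(T_n)=\infty$; (M3)$_m$ $\displaystyle\lim_{n\to\infty}\frac1{|T_n|}\sum_{v\in V(T_n)}d(v)^{m-1}=\infty$; (M4)$_m$ $\displaystyle\lim_{n\to\infty} p_2^{(m)}(T_n)=1$. Then (M1)$_k$, (M2)$_k$, (M3)$_k$ and (M4)$_k$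 are equivalent, and if one of them holds, then all of (M1)$_\ell$, (M2)$_\ell$, (M3)$_\ell$ and (M4)$_\ell$ hold as well. In particular, if $p_1^{(k)}(T_n)\to 0$, then $p_2^{(\ell)}(T_n)\to 1$. -/

import Mathlib

open Filter Topology

noncomputable section

namespace TreeProfile

universe u v

/-- The path `P_k` on `k` vertices. -/
def pathTree (k : ℕ) : SimpleGraph (Fin k) := SimpleGraph.pathGraph k

/-- The star `S_k` on `k` vertices (for `k ≥ 1`): the centre `none` and `k - 1` leaves. -/
def starTree (k : ℕ) : SimpleGraph (Option (Fin (k - 1))) :=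
  SimpleGraph.starGraph none

/-- `c(S, T)`: the number of vertex subsets of `T` that induce a graph isomorphic to `S`. -/
def copies {W : Type v} {V : Type u} (S : SimpleGraph W) (T : SimpleGraph V) : ℕ :=
  {A : Finset V | Nonempty (T.induce (A : Set V) ≃g S)}.ncard

/-- `Z_k(T)`: the number of `k`-vertex subsets of `T` that induce a tree. -/
def subtreeCount {V : Type u} (k : ℕ) (T : SimpleGraph V) : ℕ :=
  {A : Finset V | A.card = k ∧ (T.induce (A : Set V)).IsTree}.ncard

/-- `p₁^{(k)}(T)`: the proportion of paths among the `k`-vertex subtrees of `T`. -/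
def pathProportion {V : Type u} (k : ℕ) (T : SimpleGraph V) : ℝ :=
  (copies (pathTree k) T : ℝ) / (subtreeCount k T : ℝ)

/-- `p₂^{(k)}(T)`: the proportion of stars among the `k`-vertex subtrees of `T`. -/
def starProportion {V : Type u} (k : ℕ) (T : SimpleGraph V) : ℝ :=
  (copies (starTree k) T : ℝ) / (subtreeCount k T : ℝ)

open Classical in
/-- The sum of `d(v) ^ j` over all vertices `v` of `T`. -/
def degreePowerSum {V : Type u} [Fintype V] (j : ℕ) (T : SimpleGraph V) : ℕ :=
  ∑ x : V, T.degree x ^ j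

/-- (M1) for `k`: the proportion of paths tends to `0`. -/
def M1 {V : ℕ → Type u} (k : ℕ) (T : ∀ n, SimpleGraph (V n)) : Prop :=
  Tendsto (fun n => pathProportion k (T n)) atTop (𝓝 0)

/-- (M2) for `k`: the number of `k`-vertex subtrees grows superlinearly in the order. -/
def M2 {V : ℕ → Type u} [∀ n, Fintype (V n)] (k : ℕ) (T : ∀ n, SimpleGraph (V n)) : Prop :=
  Tendsto (fun n => (1 / (Fintype.card (V n) : ℝ)) * (subtreeCount k (T n) : ℝ)) atTop atTop

/-- (M3) for `k`: the sum of `(k - 1)`-th powers of the degrees grows superlinearly. -/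
def M3 {V : ℕ → Type u} [∀ n, Fintype (V n)] (k : ℕ) (T : ∀ n, SimpleGraph (V n)) : Prop :=
  Tendsto (fun n => (1 / (Fintype.card (V n) : ℝ)) * (degreePowerSum (k - 1) (T n) : ℝ))
    atTop atTop

/-- (M4) for `k`: the proportion of stars tends to `1`. -/
def M4 {V : ℕ → Type u} (k : ℕ) (T : ∀ n, SimpleGraph (V n)) : Prop :=
  Tendsto (fun n => starProportion k (T n)) atTop (𝓝 1)

end TreeProfile

end

namespace TreeProfile

universe u v

/-! ### Rooted trees and edges leaving a connected set. -/

section Geometry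

variable {V : Type u} {G : SimpleGraph V}

/-! Everything is compared with the power sum of degrees, the only quantity easily compared for
different `k`. Growing a subtree from a vertex of maximal degree bounds `Z_k` by that sum
(`subtreeCount_le`), and counting stars gives the converse up to a linear term
(`degreePowerSum_le`), so (M2) and (M3) agree.

Few paths force many subtrees: if `Z_k` is linear in the order, so is the sum of squared degrees. By
Cauchy–Schwarz, trimming leaves a fixed number of times then keeps a positive proportion of the
vertices (`exists_linear_card_core`). Each survivor of `k - 1` trims starts a `k`-vertex path, so
the path proportion stays away from 0.

Many subtrees force stars: a non-star contains an edge `wx`, with `d(w)` maximal, and a further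
neighbour of `x`. Charging along a parent function shows that these are negligible against the power
sum (`mul_sum_degree_mul_pow_le`), up to a linear error. Finally, a path on at least four vertices
is not a star, so (M4) gives (M1). -/

lemma eq_of_adj_of_dist_le (hG : G.IsTree) (r : V) {x y z : V} (hy : G.Adj x y) (hz : G.Adj x z)
    (hyd : G.dist r y ≤ G.dist r x) (hzd : G.dist r z ≤ G.dist r x) : y = z := by
  have key : ∀ y, G.Adj x y → G.dist r y ≤ G.dist r x →
      ∃ p : G.Walk r x, p.IsPath ∧ p.penultimate = y := by
    intro y hy hyd
    have h1 := hG.dist_eq_dist_add_one_of_adj r hy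
    obtain ⟨p, hp⟩ := hG.connected.exists_walk_length_eq_dist r y
    refine ⟨p.concat hy.symm, ?_, by simp⟩
    apply SimpleGraph.Walk.isPath_of_length_eq_dist
    rw [SimpleGraph.Walk.length_concat]
    omega
  obtain ⟨p, hp, rfl⟩ := key y hy hyd
  obtain ⟨q, hq, rfl⟩ := key z hz hzd
  rw [(hG.existsUnique_path r x).unique hp hq]

lemma exists_parent (hG : G.IsTree) :
    ∃ p : V → V, ∀ x y, G.Adj x y → p x = y ∨ p y = x := by
  classical
  obtain ⟨r⟩ := hG.connected.nonempty
  -- The parent is the neighbour nearer the root; the default value occurs only at the root and is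
  -- harmless.
  refine ⟨fun x => if h : ∃ y, G.Adj x y ∧ G.dist r y ≤ G.dist r x then h.choose else x, ?_⟩
  have key : ∀ x y, G.Adj x y → G.dist r y ≤ G.dist r x →
      (if h : ∃ y, G.Adj x y ∧ G.dist r y ≤ G.dist r x then h.choose else x) = y := by
    intro x y hxy hd
    have h : ∃ y, G.Adj x y ∧ G.dist r y ≤ G.dist r x := ⟨y, hxy, hd⟩
    rw [dif_pos h]
    exact eq_of_adj_of_dist_le hG r h.choose_spec.1 hxy h.choose_spec.2 hd
  intro x y hxy
  rcases le_total (G.dist r y) (G.dist r x) with h | h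
  · exact Or.inl (key x y hxy h)
  · exact Or.inr (key y x hxy.symm h)

lemma exists_adj_boundary {A B : Finset V} (hA : (G.induce (A : Set V)).Connected) (hBA : B ⊆ A)
    (hB : B.Nonempty) (hne : B ≠ A) : ∃ x ∈ B, ∃ y ∈ A, y ∉ B ∧ G.Adj x y := by
  obtain ⟨b, hb⟩ := hB
  obtain ⟨a, ha, hab⟩ : ∃ a ∈ A, a ∉ B := by
    by_contra! h
    exact hne (Finset.Subset.antisymm hBA h)
  obtain ⟨p⟩ := hA.preconnected ⟨b, hBA hb⟩ ⟨a, ha⟩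
  obtain ⟨d, -, h1, h2⟩ := p.exists_boundary_dart {z | z.1 ∈ B} hb hab
  exact ⟨d.fst, h1, d.snd, d.snd.2, h2, d.adj⟩

end Geometry

/-! ### Recognising induced stars and paths. -/

section Shapes

variable {V : Type u} {G : SimpleGraph V}

/-- Two adjacent leaves would form a triangle with the centre. -/
lemma nonempty_iso_starTree (hG : G.IsAcyclic) {k : ℕ} {A : Finset V} (hA : A.card = k) {w : V}
    (hw : w ∈ A) (hadj : ∀ x ∈ A, x ≠ w → G.Adj w x) :
    Nonempty (G.induce (A : Set V) ≃g starTree k) := by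
  classical
  have hcard : Fintype.card {x : (A : Set V) // x ≠ ⟨w, hw⟩} = Fintype.card (Fin (k - 1)) := by
    rw [Fintype.card_subtype_compl]
    simp [hA]
  let e₁ := Fintype.equivOfCardEq hcard
  let e : (A : Set V) ≃ Option (Fin (k - 1)) :=
    (Equiv.optionSubtypeNe (⟨w, hw⟩ : (A : Set V))).symm.trans (Equiv.optionCongr e₁)
  have he : ∀ x, e x = none ↔ x = ⟨w, hw⟩ := by
    intro x
    simp [e, Equiv.optionSubtypeNe_symm_apply]
  refine ⟨⟨e, ?_⟩⟩
  rintro a b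
  change (SimpleGraph.starGraph none).Adj (e a) (e b) ↔ G.Adj a b
  rw [SimpleGraph.starGraph_adj, he, he, e.injective.ne_iff]
  constructor
  · rintro ⟨hab, rfl | rfl⟩
    · exact hadj b b.2 fun h => hab (Subtype.ext h.symm)
    · exact (hadj a a.2 fun h => hab (Subtype.ext h)).symm
  · intro hab
    refine ⟨fun h => G.loopless.irrefl _ (h ▸ hab), ?_⟩
    by_contra! h
    have ha := hadj a a.2 fun h' => h.1 (Subtype.ext h')
    have hb := hadj b b.2 fun h' => h.2 (Subtype.ext h')
    refine hG.cliqueFree le_rfl {w, (a : V), (b : V)} ?_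
    exact SimpleGraph.is3Clique_triple_iff.2 ⟨ha, hb, hab⟩

lemma isTree_and_card_of_iso_starTree {k : ℕ} (hk : 1 ≤ k) {A : Finset V}
    (h : Nonempty (G.induce (A : Set V) ≃g starTree k)) :
    A.card = k ∧ (G.induce (A : Set V)).IsTree := by
  obtain ⟨e⟩ := h
  refine ⟨?_, ?_⟩
  · have := Fintype.card_congr e.toEquiv
    simp at this
    omega
  · exact e.isTree_iff.2 (SimpleGraph.isTree_starGraph _)

lemma isTree_and_card_of_iso_pathTree (hG : G.IsAcyclic) {k : ℕ} (hk : 1 ≤ k) {A : Finset V}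
    (h : Nonempty (G.induce (A : Set V) ≃g pathTree k)) :
    A.card = k ∧ (G.induce (A : Set V)).IsTree := by
  obtain ⟨e⟩ := h
  refine ⟨?_, ?_, hG.induce _⟩
  · have := Fintype.card_congr e.toEquiv
    simpa using this
  · obtain ⟨k, rfl⟩ := Nat.exists_eq_add_of_le' hk
    exact e.connected_iff.2 (SimpleGraph.pathGraph_connected k)

/-- The star's centre has at least three neighbours, a path vertex at most two; this fails at `k =
3`. -/
lemma not_iso_starTree_of_iso_pathTree {k : ℕ} (hk : 4 ≤ k) {A : Finset V}
    (h : Nonempty (G.induce (A : Set V) ≃g pathTree k)) :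
    ¬ Nonempty (G.induce (A : Set V) ≃g starTree k) := by
  rintro ⟨f⟩
  obtain ⟨e⟩ := h
  let g : starTree k ≃g pathTree k := f.symm.trans e
  set c := g none with hc
  have key : ∀ i : Fin k, i ≠ c → c.val + 1 = i ∨ i.val + 1 = c := by
    intro i hi
    have h0 : (starTree k).Adj none (g.symm i) := by
      refine SimpleGraph.starGraph_center_adj fun h => hi ?_
      rw [hc, h]; simp
    have h1 := g.map_rel_iff.2 h0
    rw [g.apply_symm_apply, ← hc] at h1
    exact SimpleGraph.pathGraph_adj.1 h1
  have k0 := key ⟨0, by omega⟩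
  have k1 := key ⟨1, by omega⟩
  have k2 := key ⟨2, by omega⟩
  have k3 := key ⟨3, by omega⟩
  simp only [ne_eq, Fin.ext_iff] at k0 k1 k2 k3
  omega

/-- Adjacent vertices of a tree differ by exactly one in distance from `f 0`, so there are no
chords. -/
lemma iso_pathTree_of_dist (hG : G.IsTree) {k : ℕ} (f : ℕ → V)
    (hadj : ∀ i, i + 1 < k → G.Adj (f i) (f (i + 1)))
    (hdist : ∀ i < k, G.dist (f 0) (f i) = i) :
    ∃ A : Finset V, (∀ i < k, f i ∈ A) ∧ Nonempty (G.induce (A : Set V) ≃g pathTree k) := by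
  let F : Fin k ↪ V := ⟨fun i => f i, fun i j h => by
    have h1 := hdist i i.2
    have h2 := hdist j j.2
    simp only at h
    rw [h] at h1
    ext
    omega⟩
  refine ⟨Finset.univ.map F, fun i hi => Finset.mem_map.2 ⟨⟨i, hi⟩, Finset.mem_univ _, rfl⟩, ?_⟩
  let e : Fin k ≃ (((Finset.univ : Finset (Fin k)).map F : Finset V) : Set V) :=
    (Equiv.ofInjective F F.injective).trans (Equiv.setCongr (by simp))
  refine ⟨SimpleGraph.Iso.symm ⟨e, ?_⟩⟩
  intro i j
  change G.Adj (f i) (f j) ↔ (SimpleGraph.pathGraph k).Adj i j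
  rw [SimpleGraph.pathGraph_adj]
  constructor
  · intro h
    have h1 := hG.dist_eq_dist_add_one_of_adj (f 0) h
    rw [hdist i i.2, hdist j j.2] at h1
    omega
  · rintro (h | h)
    · rw [← h]; exact hadj i (by omega)
    · rw [← h]; exact (hadj j (by omega)).symm

end Shapes

end TreeProfile

namespace TreeProfile

universe u v

/-! ### Trimming leaves: few subtrees force many paths. -/

section Core

open scoped Classical

variable {V : Type u}

/-- The number of neighbours of `x` in the set `S`. -/
noncomputable def degIn (G : SimpleGraph V) (S : Finset V) (x : V) : ℕ := (S.filter (G.Adj x)).card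

/-- The vertices left after trimming those of degree at most one `i` times. -/
noncomputable def core [Fintype V] (G : SimpleGraph V) : ℕ → Finset V
  | 0 => Finset.univ
  | i + 1 => (core G i).filter fun x => 2 ≤ degIn G (core G i) x

variable {G : SimpleGraph V}

/-- Each trim survived pays for one step outward: of two neighbours in the previous core, at most
one is not farther from `v`. -/
lemma exists_seq_of_mem_core [Fintype V] (hG : G.IsTree) {j : ℕ} {v : V} (hv : v ∈ core G j)
    (m : ℕ) (hm : m ≤ j) :
    ∃ f : ℕ → V, f 0 = v ∧ (∀ i ≤ m, f i ∈ core G (j - i)) ∧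
      (∀ i < m, G.Adj (f i) (f (i + 1))) ∧ ∀ i ≤ m, G.dist v (f i) = i := by
  induction m with
  | zero =>
    refine ⟨fun _ => v, rfl, ?_, ?_, ?_⟩
    · intro i hi; obtain rfl : i = 0 := by omega
      exact hv
    · intro i hi; omega
    · intro i hi; obtain rfl : i = 0 := by omega
      simp
  | succ m ih =>
    obtain ⟨f, h0, hc, ha, hd⟩ := ih (by omega)
    have hfm := hc m le_rfl
    obtain ⟨t, ht⟩ : ∃ t, j - m = t + 1 := ⟨j - m - 1, by omega⟩
    rw [ht, core, Finset.mem_filter] at hfm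
    obtain ⟨y, hy, z, hz, hyz⟩ := Finset.one_lt_card.1 (show 1 < _ from hfm.2)
    rw [Finset.mem_filter] at hy hz
    obtain ⟨x, hx, hxa, hxd⟩ : ∃ x ∈ core G t, G.Adj (f m) x ∧ G.dist v (f m) < G.dist v x := by
      by_contra! h
      exact hyz (eq_of_adj_of_dist_le hG v hy.2 hz.2 (h y hy.1 hy.2) (h z hz.1 hz.2))
    have hxd' : G.dist v x = m + 1 := by
      have := hG.dist_eq_dist_add_one_of_adj v hxa
      have := hd m le_rfl
      omega
    refine ⟨fun i => if i = m + 1 then x else f i, by simpa using h0, ?_, ?_, ?_⟩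
    · intro i hi
      by_cases h : i = m + 1
      · subst h
        simpa [show j - (m + 1) = t by omega] using hx
      · simpa [h] using hc i (by omega)
    · intro i hi
      by_cases h : i = m
      · subst h
        simpa using hxa
      · simpa [h, show i ≠ m + 1 by omega] using ha i (by omega)
    · intro i hi
      by_cases h : i = m + 1
      · subst h
        simpa using hxd'
      · simpa [h] using hd i (by omega)

lemma card_core_le_copies_pathTree [Fintype V] (hG : G.IsTree) {k : ℕ} (hk : 1 ≤ k) :
    (core G (k - 1)).card ≤ k * copies (pathTree k) G := by
  have hsub : core G (k - 1) ⊆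
      (Finset.univ.filter fun A : Finset V =>
        Nonempty (G.induce (A : Set V) ≃g pathTree k)).biUnion id := by
    intro v hv
    obtain ⟨f, h0, -, ha, hd⟩ := exists_seq_of_mem_core hG hv (k - 1) le_rfl
    obtain ⟨A, hA, hiso⟩ := iso_pathTree_of_dist hG (k := k) f (fun i hi => ha i (by omega))
      (fun i hi => h0 ▸ hd i (by omega))
    rw [Finset.mem_biUnion]
    exact ⟨A, by simpa using hiso, h0 ▸ hA 0 (by omega)⟩
  refine (Finset.card_le_card hsub).trans ?_
  rw [copies, ← Finset.coe_filter_univ, Set.ncard_coe_finset, mul_comm]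
  refine Finset.card_biUnion_le_card_mul _ _ _ ?_
  intro A hA
  exact (isTree_and_card_of_iso_pathTree hG.isAcyclic hk (Finset.mem_filter.1 hA).2).1.le

/-- Initially this is the edge count of a tree. A trimmed vertex has at most one neighbour in the
core, so removing it lowers the inner degree sum by at most two. The inequality replaces a proof
that cores stay connected. -/
lemma two_mul_card_core_le [Fintype V] (hG : G.IsTree) (i : ℕ) :
    2 * (core G i).card ≤ ∑ x ∈ core G i, degIn G (core G i) x + 2 := by
  induction i with
  | zero =>
    have h1 := hG.card_edgeFinset
    have h2 := G.sum_degrees_eq_twice_card_edges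
    have h3 : ∑ x ∈ core G 0, degIn G (core G 0) x = ∑ x, G.degree x := by
      refine Finset.sum_congr rfl fun x _ => ?_
      simp [degIn, core, ← SimpleGraph.card_neighborFinset_eq_degree,
        SimpleGraph.neighborFinset_eq_filter]
    rw [h3, h2]
    simp only [core, Finset.card_univ]
    omega
  | succ i ih =>
    set S := core G i with hS
    have hS' : core G (i + 1) = S.filter fun x => 2 ≤ degIn G S x := rfl
    set S' := core G (i + 1)
    set L := S.filter fun x => ¬ 2 ≤ degIn G S x with hL
    have hcard : S'.card + L.card = S.card := by
      rw [hS']; exact Finset.card_filter_add_card_filter_not _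
    have hsum : ∑ x ∈ S', degIn G S x + ∑ x ∈ L, degIn G S x = ∑ x ∈ S, degIn G S x := by
      rw [hS']; exact Finset.sum_filter_add_sum_filter_not _ _ _
    have hLsum : ∑ x ∈ L, degIn G S x ≤ L.card := by
      refine (Finset.sum_le_card_nsmul L _ 1 fun x hx => ?_).trans (by simp)
      have := (Finset.mem_filter.1 hx).2
      omega
    have hsplit : ∀ x, degIn G S x = degIn G S' x + degIn G L x := by
      intro x
      simp only [degIn]
      rw [hS', hL, ← Finset.card_union_of_disjoint, ← Finset.filter_union,
        Finset.filter_union_filter_not_eq]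
      exact Finset.disjoint_filter_filter (Finset.disjoint_filter_filter_not _ _ _)
    have hswap : ∑ x ∈ S', degIn G L x = ∑ x ∈ L, degIn G S' x := by
      have := Finset.sum_card_bipartiteAbove_eq_sum_card_bipartiteBelow (s := S') (t := L) G.Adj
      simp only [Finset.bipartiteAbove, Finset.bipartiteBelow] at this
      simpa only [degIn, G.adj_comm] using this
    have hle : ∑ x ∈ L, degIn G S' x ≤ ∑ x ∈ L, degIn G S x :=
      Finset.sum_le_sum fun x _ => by rw [hsplit x]; omega
    have hS'sum : ∑ x ∈ S', degIn G S x = ∑ x ∈ S', degIn G S' x + ∑ x ∈ S', degIn G L x := by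
      rw [← Finset.sum_add_distrib]
      exact Finset.sum_congr rfl fun x _ => hsplit x
    omega

lemma degIn_le_degree [Fintype V] (S : Finset V) (x : V) : degIn G S x ≤ G.degree x := by
  rw [← SimpleGraph.card_neighborFinset_eq_degree, degIn]
  exact Finset.card_le_card fun y hy => by simpa using (Finset.mem_filter.1 hy).2

/-- Trimmed vertices have inner degree at most one, so the survivors carry degree sum at least `|S|
- 2`; Cauchy–Schwarz then bounds their number from below. -/
lemma sq_card_core_sub_two_le [Fintype V] (hG : G.IsTree) (i : ℕ) :
    ((core G i).card - 2) ^ 2 ≤ (core G (i + 1)).card * degreePowerSum 2 G := by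
  have ih := two_mul_card_core_le hG i
  set S := core G i with hS
  have hS' : core G (i + 1) = S.filter fun x => 2 ≤ degIn G S x := rfl
  set S' := core G (i + 1)
  set L := S.filter fun x => ¬ 2 ≤ degIn G S x with hL
  have hcard : S'.card + L.card = S.card := by
    rw [hS']; exact Finset.card_filter_add_card_filter_not _
  have hsum : ∑ x ∈ S', degIn G S x + ∑ x ∈ L, degIn G S x = ∑ x ∈ S, degIn G S x := by
    rw [hS']; exact Finset.sum_filter_add_sum_filter_not _ _ _
  have hLsum : ∑ x ∈ L, degIn G S x ≤ L.card := by
    refine (Finset.sum_le_card_nsmul L _ 1 fun x hx => ?_).trans (by simp)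
    have := (Finset.mem_filter.1 hx).2
    omega
  have hle : ∑ x ∈ S', degIn G S x ≤ ∑ x ∈ S', G.degree x :=
    Finset.sum_le_sum fun x _ => degIn_le_degree S x
  calc (S.card - 2) ^ 2 ≤ (∑ x ∈ S', G.degree x) ^ 2 := Nat.pow_le_pow_left (by omega) 2
    _ ≤ S'.card * ∑ x ∈ S', G.degree x ^ 2 := sq_sum_le_card_mul_sum_sq
    _ ≤ S'.card * degreePowerSum 2 G := by
        refine Nat.mul_le_mul_left _ ?_
        exact Finset.sum_le_sum_of_subset (Finset.subset_univ _)

lemma exists_linear_card_core {C : ℝ} (hC : 0 < C) (i : ℕ) :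
    ∃ c > (0 : ℝ), ∃ N : ℕ, ∀ (V : Type u) [Fintype V] (G : SimpleGraph V), G.IsTree →
      N ≤ Fintype.card V → (degreePowerSum 2 G : ℝ) ≤ C * Fintype.card V →
      c * Fintype.card V ≤ (core G i).card := by
  induction i with
  | zero =>
    refine ⟨1, one_pos, 0, fun V _ G _ _ _ => ?_⟩
    simp [core]
  | succ i ih =>
    obtain ⟨c, hc, N, h⟩ := ih
    -- Beyond `4 / c` one has `c * n - 2 ≥ c * n / 2`; squaring and dividing by `C * n` gives the
    -- new constant.
    refine ⟨c ^ 2 / (4 * C), by positivity, max N (⌈4 / c⌉₊ + 1), fun V _ G hG hN hsum => ?_⟩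
    have h1 := h V G hG ((le_max_left _ _).trans hN) hsum
    have hN2 : (⌈4 / c⌉₊ + 1 : ℕ) ≤ Fintype.card V := (le_max_right _ _).trans hN
    have hn : 4 / c ≤ (Fintype.card V : ℝ) := (Nat.le_ceil _).trans (by exact_mod_cast by omega)
    have hn0 : (0 : ℝ) < Fintype.card V := by exact_mod_cast by omega
    set n : ℝ := (Fintype.card V : ℝ)
    rw [div_le_iff₀ hc] at hn
    have h2 : ((core G i).card : ℝ) - 2 ≤ ((core G i).card - 2 : ℕ) := by
      rw [sub_le_iff_le_add]; exact_mod_cast by omega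
    have h3 : (((core G i).card - 2 : ℕ) : ℝ) ^ 2 ≤ (core G (i + 1)).card * degreePowerSum 2 G := by
      exact_mod_cast sq_card_core_sub_two_le hG i
    have h4 : (c * n / 2) ^ 2 ≤ (core G (i + 1)).card * (C * n) :=
      (pow_le_pow_left₀ (by positivity) (by linarith) 2).trans
        (h3.trans (mul_le_mul_of_nonneg_left hsum (by positivity)))
    have h5 : (c ^ 2 * n) * n ≤ (4 * C * (core G (i + 1)).card) * n := by nlinarith
    have h6 := le_of_mul_le_mul_right h5 hn0
    rw [div_mul_eq_mul_div, div_le_iff₀ (by positivity)]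
    linarith

end Core

end TreeProfile

namespace TreeProfile

universe u v

/-! ### Counting subtrees, stars and non-stars through degrees. -/

section Counting

open scoped Classical

variable {V : Type u} [Fintype V] {G : SimpleGraph V}

/-- The connected `n`-vertex sets containing `B` whose vertices have degree at most `d` in `G`. -/
noncomputable def connectedSupersets (G : SimpleGraph V) (d n : ℕ) (B : Finset V) :
    Finset (Finset V) :=
  Finset.univ.filter fun A => B ⊆ A ∧ A.card = n ∧ (G.induce (A : Set V)).Connected ∧
    ∀ x ∈ A, G.degree x ≤ d

/-- Until `B` fills `A`, some edge inside `A` leaves `B`; it starts at one of at most `n` vertices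
and has at most `d` continuations. -/
lemma card_connectedSupersets_le (d n m : ℕ) (B : Finset V) (hB : B.Nonempty)
    (hn : n = B.card + m) : (connectedSupersets G d n B).card ≤ (n * d) ^ m := by
  induction m generalizing B with
  | zero =>
    rw [pow_zero]
    refine (Finset.card_le_card (t := {B}) fun A hA => ?_).trans (by simp)
    obtain ⟨hBA, hA, -⟩ := (Finset.mem_filter.1 hA).2
    exact Finset.mem_singleton.2 (Finset.eq_of_subset_of_card_le hBA (by omega)).symm
  | succ m ih =>
    have hsub : connectedSupersets G d n B ⊆ (B.filter fun x => G.degree x ≤ d).biUnion fun x =>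
        (G.neighborFinset x \ B).biUnion fun y => connectedSupersets G d n (insert y B) := by
      intro A hA
      obtain ⟨hBA, hA, hconn, hd⟩ := (Finset.mem_filter.1 hA).2
      obtain ⟨x, hx, y, hy, hyB, hxy⟩ := exists_adj_boundary hconn hBA hB (by
        rintro rfl; omega)
      simp only [Finset.mem_biUnion, Finset.mem_filter, Finset.mem_sdiff,
        SimpleGraph.mem_neighborFinset]
      exact ⟨x, ⟨hx, hd x (hBA hx)⟩, y, ⟨hxy, hyB⟩, Finset.mem_filter.2
        ⟨Finset.mem_univ _, Finset.insert_subset hy hBA, hA, hconn, hd⟩⟩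
    refine (Finset.card_le_card hsub).trans ?_
    refine (Finset.card_biUnion_le_card_mul _ _ (d * (n * d) ^ m) fun x hx => ?_).trans ?_
    · refine (Finset.card_biUnion_le_card_mul _ _ ((n * d) ^ m) fun y hy => ?_).trans ?_
      · refine ih _ (Finset.insert_nonempty _ _) ?_
        rw [Finset.card_insert_of_notMem (Finset.mem_sdiff.1 hy).2]
        omega
      · refine Nat.mul_le_mul_right _ ?_
        refine (Finset.card_le_card Finset.sdiff_subset).trans ?_
        rw [SimpleGraph.card_neighborFinset_eq_degree]
        exact (Finset.mem_filter.1 hx).2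
    · rw [pow_succ', mul_assoc]
      refine Nat.mul_le_mul_right _ ?_
      have := Finset.card_filter_le B fun x => G.degree x ≤ d
      omega

lemma subtreeCount_eq_card (k : ℕ) : subtreeCount k G =
    (Finset.univ.filter fun A : Finset V => A.card = k ∧ (G.induce (A : Set V)).IsTree).card := by
  rw [subtreeCount, ← Finset.coe_filter_univ, Set.ncard_coe_finset]

lemma copies_eq_card {W : Type v} (S : SimpleGraph W) : copies S G =
    (Finset.univ.filter fun A : Finset V => Nonempty (G.induce (A : Set V) ≃g S)).card := by
  rw [copies, ← Finset.coe_filter_univ, Set.ncard_coe_finset]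

lemma subtreeCount_le {k : ℕ} (hk : 1 ≤ k) :
    subtreeCount k G ≤ k ^ (k - 1) * degreePowerSum (k - 1) G := by
  have hsub : (Finset.univ.filter fun A : Finset V =>
      A.card = k ∧ (G.induce (A : Set V)).IsTree) ⊆
      Finset.univ.biUnion fun w => connectedSupersets G (G.degree w) k {w} := by
    intro A hA
    obtain ⟨hcard, htree⟩ := (Finset.mem_filter.1 hA).2
    obtain ⟨w, hw, hmax⟩ := A.exists_max_image (fun x => G.degree x)
      (Finset.card_pos.1 (by omega))
    exact Finset.mem_biUnion.2 ⟨w, Finset.mem_univ _, Finset.mem_filter.2 ⟨Finset.mem_univ _,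
      Finset.singleton_subset_iff.2 hw, hcard, htree.connected, hmax⟩⟩
  rw [subtreeCount_eq_card, degreePowerSum, Finset.mul_sum]
  refine (Finset.card_le_card hsub).trans (Finset.card_biUnion_le.trans ?_)
  refine Finset.sum_le_sum fun w _ => ?_
  rw [← mul_pow]
  exact card_connectedSupersets_le _ _ _ _ (Finset.singleton_nonempty w) (by simp; omega)

/-- The number of `k`-vertex subtrees of `G` that are not stars. -/
noncomputable def nonStarCount (k : ℕ) (G : SimpleGraph V) : ℕ :=
  (Finset.univ.filter fun A : Finset V => (A.card = k ∧ (G.induce (A : Set V)).IsTree) ∧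
    ¬ Nonempty (G.induce (A : Set V) ≃g starTree k)).card

lemma copies_starTree_add_nonStarCount {k : ℕ} (hk : 1 ≤ k) :
    copies (starTree k) G + nonStarCount k G = subtreeCount k G := by
  rw [subtreeCount_eq_card, copies_eq_card, nonStarCount,
    ← Finset.card_filter_add_card_filter_not (s := Finset.univ.filter fun A : Finset V =>
      A.card = k ∧ (G.induce (A : Set V)).IsTree)
      (fun A => Nonempty (G.induce (A : Set V) ≃g starTree k)),
    Finset.filter_filter, Finset.filter_filter]
  congr 2
  ext A
  simp only [Finset.mem_filter, Finset.mem_univ, true_and]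
  exact ⟨fun h => ⟨isTree_and_card_of_iso_starTree hk h, h⟩, fun h => h.2⟩

lemma copies_pathTree_le_nonStarCount (hG : G.IsAcyclic) {k : ℕ} (hk : 4 ≤ k) :
    copies (pathTree k) G ≤ nonStarCount k G := by
  rw [copies_eq_card, nonStarCount]
  refine Finset.card_le_card fun A hA => ?_
  have h := (Finset.mem_filter.1 hA).2
  exact Finset.mem_filter.2 ⟨Finset.mem_univ _,
    isTree_and_card_of_iso_pathTree hG (by omega) h, not_iso_starTree_of_iso_pathTree hk h⟩

/-- Let `w` have maximal degree in a non-star. Some edge `xy` leaves the closed neighbourhood of `w`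
in the subtree, with `x` adjacent to `w`. There are at most `d(x)` choices of `y`, and each of the
other `k - 3` vertices costs a factor `k * d(w)`. -/
lemma nonStarCount_le (hG : G.IsAcyclic) {k : ℕ} (hk : 3 ≤ k) :
    nonStarCount k G ≤ k ^ (k - 3) * ∑ w, ∑ x ∈ G.neighborFinset w with G.degree x ≤ G.degree w,
      G.degree x * G.degree w ^ (k - 3) := by
  have hsub : (Finset.univ.filter fun A : Finset V =>
      (A.card = k ∧ (G.induce (A : Set V)).IsTree) ∧
        ¬ Nonempty (G.induce (A : Set V) ≃g starTree k)) ⊆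
      Finset.univ.biUnion fun w =>
        ((G.neighborFinset w).filter fun x => G.degree x ≤ G.degree w).biUnion fun x =>
          (G.neighborFinset x \ {w}).biUnion fun y =>
            connectedSupersets G (G.degree w) k {w, x, y} := by
    intro A hA
    obtain ⟨⟨hcard, htree⟩, hstar⟩ := (Finset.mem_filter.1 hA).2
    obtain ⟨w, hw, hmax⟩ := A.exists_max_image (fun x => G.degree x)
      (Finset.card_pos.1 (by omega))
    obtain ⟨x, hx, y, hy, hyB, hxy⟩ := exists_adj_boundary (B := insert w (A.filter (G.Adj w)))
      htree.connected (Finset.insert_subset hw (Finset.filter_subset _ _))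
      (Finset.insert_nonempty _ _) (by
        intro h
        refine hstar (nonempty_iso_starTree hG hcard hw fun x hx hxw => ?_)
        rw [← h, Finset.mem_insert, Finset.mem_filter] at hx
        exact (hx.resolve_left hxw).2)
    simp only [Finset.mem_insert, Finset.mem_filter, not_or, not_and] at hx hyB
    have hxw : x ≠ w := by
      rintro rfl
      exact hyB.2 hy hxy
    obtain ⟨hxA, hwx⟩ := hx.resolve_left hxw
    simp only [Finset.mem_biUnion, Finset.mem_univ, true_and, Finset.mem_filter, Finset.mem_sdiff,
      SimpleGraph.mem_neighborFinset, Finset.mem_singleton]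
    refine ⟨w, x, ⟨hwx, hmax x hxA⟩, y, ⟨hxy, hyB.1⟩, Finset.mem_filter.2
      ⟨Finset.mem_univ _, ?_, hcard, htree.connected, hmax⟩⟩
    intro z hz
    simp only [Finset.mem_insert, Finset.mem_singleton] at hz
    rcases hz with rfl | rfl | rfl <;> assumption
  rw [nonStarCount, Finset.mul_sum]
  refine (Finset.card_le_card hsub).trans (Finset.card_biUnion_le.trans ?_)
  refine Finset.sum_le_sum fun w _ => Finset.card_biUnion_le.trans ?_
  rw [Finset.mul_sum]
  refine Finset.sum_le_sum fun x hx => ?_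
  rw [mul_left_comm, ← mul_pow]
  refine (Finset.card_biUnion_le_card_mul _ _ _ fun y hy => ?_).trans (Nat.mul_le_mul_right _ ?_)
  · refine card_connectedSupersets_le _ _ _ _ (Finset.insert_nonempty _ _) ?_
    rw [Finset.mem_filter, SimpleGraph.mem_neighborFinset] at hx
    rw [Finset.mem_sdiff, SimpleGraph.mem_neighborFinset, Finset.mem_singleton] at hy
    rw [Finset.card_eq_three.2 ⟨w, x, y, hx.1.ne, Ne.symm hy.2, hy.1.ne, rfl⟩]
    omega
  · exact (Finset.card_le_card Finset.sdiff_subset).trans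
      (G.card_neighborFinset_eq_degree x).le

/-- A centre with `k - 1` of its neighbours is encoded injectively as a star with one marked vertex.
-/
lemma sum_choose_degree_le (hG : G.IsAcyclic) {k : ℕ} (hk : 1 ≤ k) :
    ∑ x, (G.degree x).choose (k - 1) ≤ k * copies (starTree k) G := by
  have h1 : ∑ x, (G.degree x).choose (k - 1) =
      (Finset.univ.sigma fun x => (G.neighborFinset x).powersetCard (k - 1)).card := by
    simp [Finset.card_sigma]
  have h2 : ∑ A ∈ Finset.univ.filter (fun A : Finset V =>
      Nonempty (G.induce (A : Set V) ≃g starTree k)), A.card =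
      k * copies (starTree k) G := by
    rw [Finset.sum_congr rfl fun A hA =>
      (isTree_and_card_of_iso_starTree hk (Finset.mem_filter.1 hA).2).1, copies_eq_card]
    simp [mul_comm]
  rw [h1, ← h2, ← Finset.card_sigma _ fun A : Finset V => A]
  refine Finset.card_le_card_of_injOn (fun q => ⟨insert q.1 q.2, q.1⟩) ?_ ?_
  · rintro ⟨x, L⟩ hL
    simp only [Finset.mem_sigma, Finset.mem_coe, Finset.mem_univ, true_and,
      Finset.mem_powersetCard] at hL
    have hx : x ∉ L := fun h => G.loopless.irrefl x (by simpa using hL.1 h)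
    simp only [Finset.mem_sigma, Finset.mem_coe, Finset.mem_filter, Finset.mem_univ, true_and,
      Finset.mem_insert_self, and_true]
    refine nonempty_iso_starTree hG (w := x) ?_ (Finset.mem_insert_self _ _) fun y hy hyx => ?_
    · rw [Finset.card_insert_of_notMem hx]
      omega
    · simpa using hL.1 ((Finset.mem_insert.1 hy).resolve_left hyx)
  · rintro ⟨x, L⟩ hL ⟨y, M⟩ hM h
    simp only [Finset.mem_sigma, Finset.mem_coe, Finset.mem_univ, true_and,
      Finset.mem_powersetCard] at hL hM
    have hx : x ∉ L := fun h => G.loopless.irrefl x (by simpa using hL.1 h)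
    have hy : y ∉ M := fun h => G.loopless.irrefl y (by simpa using hM.1 h)
    simp only [Sigma.mk.injEq, heq_eq_eq] at h
    obtain ⟨h, rfl⟩ := h
    rw [← Finset.erase_insert hx, h, Finset.erase_insert hy]

/-- For `d ≥ 2j` every factor of the falling factorial is at least `d / 2`; smaller `d` are absorbed
in the constant. -/
lemma pow_le_choose (d j : ℕ) :
    d ^ j ≤ 2 ^ j * j.factorial * d.choose j + (2 * j) ^ j := by
  rcases le_total (2 * j) d with h | h
  · refine le_add_right ?_
    calc d ^ j ≤ (2 * (d + 1 - j)) ^ j := Nat.pow_le_pow_left (by omega) j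
      _ = 2 ^ j * (d + 1 - j) ^ j := mul_pow _ _ _
      _ ≤ 2 ^ j * d.descFactorial j := Nat.mul_le_mul_left _ (Nat.pow_sub_le_descFactorial d j)
      _ = 2 ^ j * j.factorial * d.choose j := by
        rw [Nat.descFactorial_eq_factorial_mul_choose, mul_assoc]
  · exact le_add_left (Nat.pow_le_pow_left h j)

lemma degreePowerSum_le (hG : G.IsAcyclic) {k : ℕ} (hk : 1 ≤ k) :
    degreePowerSum (k - 1) G ≤ 2 ^ (k - 1) * (k - 1).factorial * k * copies (starTree k) G +
      (2 * (k - 1)) ^ (k - 1) * Fintype.card V := by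
  calc degreePowerSum (k - 1) G
      ≤ ∑ x, (2 ^ (k - 1) * (k - 1).factorial * (G.degree x).choose (k - 1) +
          (2 * (k - 1)) ^ (k - 1)) := Finset.sum_le_sum fun x _ => pow_le_choose _ _
    _ = 2 ^ (k - 1) * (k - 1).factorial * ∑ x, (G.degree x).choose (k - 1) +
          (2 * (k - 1)) ^ (k - 1) * Fintype.card V := by
        rw [Finset.sum_add_distrib, Finset.mul_sum]
        simp [mul_comm]
    _ ≤ _ := by
        rw [mul_assoc _ k]
        gcongr
        exact sum_choose_degree_le hG hk

/-- If `x` is the parent of `w`, the term is charged to `w`. Otherwise `w` is the parent of `x`: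
when `M * d(x) ≤ d(w)` the factor `M` is free, and when `d(w) ≤ M * d(x)` the term is charged to
`x`. Parents being unique, each vertex is charged at most twice, at the lower exponent `j + 1`. -/
lemma mul_sum_degree_mul_pow_le (hG : G.IsTree) (j : ℕ) {M : ℕ} (hM : 1 ≤ M) :
    M * ∑ w, ∑ x ∈ G.neighborFinset w with G.degree x ≤ G.degree w,
        G.degree x * G.degree w ^ j ≤
      degreePowerSum (j + 2) G + 2 * M ^ (j + 1) * degreePowerSum (j + 1) G := by
  obtain ⟨p, hp⟩ := exists_parent hG
  have hpt : ∀ w, ∀ x ∈ G.neighborFinset w, G.degree x ≤ G.degree w →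
      M * (G.degree x * G.degree w ^ j) ≤ G.degree w ^ (j + 1) +
        ((if p w = x then M ^ (j + 1) * G.degree w ^ (j + 1) else 0) +
          if p x = w then M ^ (j + 1) * G.degree x ^ (j + 1) else 0) := by
    intro w x hx hd
    rw [SimpleGraph.mem_neighborFinset] at hx
    generalize G.degree x = a at *
    generalize G.degree w = b at *
    rcases hp w x hx with h | h
    · rw [if_pos h]
      calc M * (a * b ^ j) ≤ M ^ (j + 1) * (b * b ^ j) := by
            gcongr
            exact Nat.le_self_pow (by omega) M
        _ = M ^ (j + 1) * b ^ (j + 1) := by rw [pow_succ' b]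
        _ ≤ _ := by omega
    · rw [if_pos h]
      rcases le_total (M * a) b with h' | h'
      · calc M * (a * b ^ j) = (M * a) * b ^ j := by ring
          _ ≤ b * b ^ j := Nat.mul_le_mul_right _ h'
          _ = b ^ (j + 1) := (pow_succ' b j).symm
          _ ≤ _ := by omega
      · calc M * (a * b ^ j) ≤ M * (a * (M * a) ^ j) := by gcongr
          _ = M ^ (j + 1) * a ^ (j + 1) := by ring
          _ ≤ _ := by omega
  have h1 : ∀ w, M * ∑ x ∈ G.neighborFinset w with G.degree x ≤ G.degree w,
      G.degree x * G.degree w ^ j ≤ G.degree w ^ (j + 2) + (M ^ (j + 1) * G.degree w ^ (j + 1) +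
        ∑ x, if p x = w then M ^ (j + 1) * G.degree x ^ (j + 1) else 0) := by
    intro w
    rw [Finset.mul_sum]
    calc _ ≤ ∑ x ∈ G.neighborFinset w with G.degree x ≤ G.degree w, (G.degree w ^ (j + 1) +
        ((if p w = x then M ^ (j + 1) * G.degree w ^ (j + 1) else 0) +
          if p x = w then M ^ (j + 1) * G.degree x ^ (j + 1) else 0)) :=
          Finset.sum_le_sum fun x hx =>
            hpt w x (Finset.mem_filter.1 hx).1 (Finset.mem_filter.1 hx).2
      _ ≤ ∑ x ∈ G.neighborFinset w, G.degree w ^ (j + 1) +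
        (∑ x, (if p w = x then M ^ (j + 1) * G.degree w ^ (j + 1) else 0) +
          ∑ x, if p x = w then M ^ (j + 1) * G.degree x ^ (j + 1) else 0) := by
          rw [Finset.sum_add_distrib, Finset.sum_add_distrib]
          gcongr
          · exact Finset.filter_subset _ _
          · exact Finset.subset_univ _
          · exact Finset.subset_univ _
      _ = _ := by
          rw [Finset.sum_const, G.card_neighborFinset_eq_degree, smul_eq_mul, ← pow_succ',
            Finset.sum_ite_eq, if_pos (Finset.mem_univ _)]
  rw [Finset.mul_sum]
  refine (Finset.sum_le_sum fun w _ => h1 w).trans (le_of_eq ?_)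
  rw [Finset.sum_add_distrib, Finset.sum_add_distrib, Finset.sum_comm]
  simp only [Finset.sum_ite_eq, Finset.mem_univ, if_true, degreePowerSum, ← Finset.mul_sum]
  ring

/-- Degrees at least `L` gain a factor `L` from one more power; the others contribute only linearly.
-/
lemma mul_degreePowerSum_le (j L : ℕ) :
    L * degreePowerSum j G ≤ degreePowerSum (j + 1) G + L ^ (j + 1) * Fintype.card V := by
  simp only [degreePowerSum]
  calc L * ∑ x, G.degree x ^ j ≤ ∑ x, (G.degree x ^ (j + 1) + L ^ (j + 1)) := by
        rw [Finset.mul_sum]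
        refine Finset.sum_le_sum fun x _ => ?_
        rcases le_total L (G.degree x) with h | h
        · refine le_add_right ?_
          rw [pow_succ']
          exact Nat.mul_le_mul_right _ h
        · refine le_add_left ?_
          rw [pow_succ' L]
          exact Nat.mul_le_mul_left _ (Nat.pow_le_pow_left h j)
    _ = _ := by
        rw [Finset.sum_add_distrib]
        simp [mul_comm]

/-- The coefficient of the power sum does not depend on `M`, only the linear error does; so large
`M` makes non-stars negligible. -/
lemma exists_mul_nonStarCount_le (k M : ℕ) (hk : 3 ≤ k) (hM : 1 ≤ M) :
    ∃ C : ℕ, ∀ (V : Type u) [Fintype V] (G : SimpleGraph V), G.IsTree →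
      M * nonStarCount k G ≤
        2 * k ^ (k - 3) * degreePowerSum (k - 1) G + C * Fintype.card V := by
  refine ⟨k ^ (k - 3) * (2 * M ^ (k - 3 + 1)) ^ (k - 3 + 1 + 1), fun V _ G hG => ?_⟩
  have h1 := nonStarCount_le hG.isAcyclic hk
  have h2 := mul_sum_degree_mul_pow_le hG (k - 3) hM
  have h3 := mul_degreePowerSum_le (G := G) (k - 3 + 1) (2 * M ^ (k - 3 + 1))
  rw [show k - 3 + 2 = k - 1 by omega] at h2
  rw [show k - 3 + 1 + 1 = k - 1 by omega] at *
  calc M * nonStarCount k G ≤ M * _ := Nat.mul_le_mul_left _ h1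
    _ = k ^ (k - 3) * (M * _) := mul_left_comm _ _ _
    _ ≤ k ^ (k - 3) * (2 * degreePowerSum (k - 1) G +
          (2 * M ^ (k - 3 + 1)) ^ (k - 1) * Fintype.card V) :=
        Nat.mul_le_mul_left _ (by omega)
    _ = _ := by ring

end Counting

end TreeProfile

/-! ### Passage to limits. -/

namespace TreeProfile

universe u

lemma degreePowerSum_mono {V : Type u} [Fintype V] {G : SimpleGraph V} {i j : ℕ} (hi : 1 ≤ i)
    (hij : i ≤ j) : degreePowerSum i G ≤ degreePowerSum j G := by
  classical
  refine Finset.sum_le_sum fun x _ => ?_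
  rcases Nat.eq_zero_or_pos (G.degree x) with h | h
  · rw [h, zero_pow (by omega), zero_pow (by omega)]
  · exact Nat.pow_le_pow_right h hij

lemma exists_degreePowerSum_le {k : ℕ} (hk : 1 ≤ k) :
    ∃ a > (0 : ℝ), ∃ b ≥ (0 : ℝ), ∀ (V : Type u) [Fintype V] (G : SimpleGraph V), G.IsTree →
      (degreePowerSum (k - 1) G : ℝ) ≤ a * copies (starTree k) G + b * Fintype.card V := by
  refine ⟨(2 ^ (k - 1) * (k - 1).factorial * k : ℕ), ?_, ((2 * (k - 1)) ^ (k - 1) : ℕ),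
    Nat.cast_nonneg _, fun V _ G hG => ?_⟩
  · have := Nat.factorial_pos (k - 1)
    exact_mod_cast (by positivity : 0 < 2 ^ (k - 1) * (k - 1).factorial * k)
  · exact_mod_cast degreePowerSum_le hG.isAcyclic hk

lemma copies_starTree_le {V : Type u} [Fintype V] (G : SimpleGraph V) {k : ℕ} (hk : 1 ≤ k) :
    copies (starTree k) G ≤ subtreeCount k G :=
  (copies_starTree_add_nonStarCount (G := G) hk).symm ▸ Nat.le_add_right _ _

lemma copies_pathTree_add_copies_starTree_le {V : Type u} [Fintype V] {G : SimpleGraph V}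
    (hG : G.IsAcyclic) {k : ℕ} (hk : 4 ≤ k) :
    copies (pathTree k) G + copies (starTree k) G ≤ subtreeCount k G := by
  have h1 := copies_starTree_add_nonStarCount (G := G) (k := k) (by omega)
  have h2 := copies_pathTree_le_nonStarCount hG hk
  omega

lemma exists_linear_copies_pathTree {k : ℕ} (hk : 3 ≤ k) {C : ℝ} (hC : 0 < C) :
    ∃ c > (0 : ℝ), ∃ N : ℕ, ∀ (V : Type u) [Fintype V] (G : SimpleGraph V), G.IsTree →
      N ≤ Fintype.card V → (subtreeCount k G : ℝ) ≤ C * Fintype.card V →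
      c * Fintype.card V ≤ copies (pathTree k) G := by
  obtain ⟨a, ha, b, hb, hab⟩ := exists_degreePowerSum_le.{u} (k := k) (by omega)
  obtain ⟨c, hc, N, h⟩ := exists_linear_card_core.{u} (C := a * C + b) (by positivity) (k - 1)
  have hk0 : (0 : ℝ) < k := by exact_mod_cast (by omega : 0 < k)
  refine ⟨c / k, by positivity, N, fun V _ G hG hN hZ => ?_⟩
  have h1 : (degreePowerSum 2 G : ℝ) ≤ (a * C + b) * Fintype.card V := by
    have h2 : (degreePowerSum 2 G : ℝ) ≤ degreePowerSum (k - 1) G := by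
      exact_mod_cast degreePowerSum_mono (by omega) (by omega)
    have h3 : (copies (starTree k) G : ℝ) ≤ subtreeCount k G := by
      exact_mod_cast copies_starTree_le G (by omega)
    have h4 := mul_le_mul_of_nonneg_left (h3.trans hZ) ha.le
    have h5 := hab V G hG
    linarith
  have h6 := h V G hG hN h1
  have h7 : ((core G (k - 1)).card : ℝ) ≤ k * copies (pathTree k) G := by
    exact_mod_cast card_core_le_copies_pathTree hG (by omega)
  rw [div_mul_eq_mul_div, div_le_iff₀ hk0]
  linarith

section Limits

variable {V : ℕ → Type u} [∀ n, Fintype (V n)] {T : ∀ n, SimpleGraph (V n)} {k l : ℕ}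

lemma card_pos_of_isTree (hT : ∀ n, (T n).IsTree) (n : ℕ) : (0 : ℝ) < Fintype.card (V n) := by
  have := (hT n).connected.nonempty
  exact_mod_cast Fintype.card_pos

lemma M2.m3 (hk : 1 ≤ k) (h : M2 k T) : M3 k T := by
  have hK : (0 : ℝ) < (k ^ (k - 1) : ℕ) := by
    exact_mod_cast Nat.pow_pos (by omega)
  refine tendsto_atTop_mono (fun n => ?_) (h.const_mul_atTop (inv_pos.2 hK))
  have h1 : (subtreeCount k (T n) : ℝ) ≤ (k ^ (k - 1) : ℕ) * degreePowerSum (k - 1) (T n) := by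
    exact_mod_cast subtreeCount_le (G := T n) hk
  rw [inv_mul_le_iff₀ hK, mul_left_comm]
  exact mul_le_mul_of_nonneg_left h1 (by positivity)

lemma M3.m2 (hT : ∀ n, (T n).IsTree) (hk : 1 ≤ k) (h : M3 k T) : M2 k T := by
  obtain ⟨a, ha, b, hb, hab⟩ := exists_degreePowerSum_le.{u} hk
  refine tendsto_atTop_mono (fun n => ?_)
    ((tendsto_atTop_add_const_right _ (-b) h).const_mul_atTop (inv_pos.2 ha))
  have h1 := hab _ _ (hT n)
  have h2 : (copies (starTree k) (T n) : ℝ) ≤ subtreeCount k (T n) := by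
    exact_mod_cast copies_starTree_le (T n) hk
  have hn := card_pos_of_isTree hT n
  have h3 := mul_le_mul_of_nonneg_left h2 ha.le
  rw [inv_mul_le_iff₀ ha, ← sub_eq_add_neg, sub_le_iff_le_add, one_div, inv_mul_le_iff₀ hn]
  have h4 : (Fintype.card (V n) : ℝ) *
      (a * ((Fintype.card (V n) : ℝ)⁻¹ * subtreeCount k (T n)) + b) =
      a * subtreeCount k (T n) + b * Fintype.card (V n) := by
    field_simp
  linarith

lemma M1.m2 (hT : ∀ n, (T n).IsTree)
    (hsize : Tendsto (fun n => Fintype.card (V n)) atTop atTop) (hk : 4 ≤ k) (h : M1 k T) :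
    M2 k T := by
  refine tendsto_atTop.2 fun b => ?_
  set C := max b 1 with hCdef
  have hC : 0 < C := lt_of_lt_of_le one_pos (le_max_right _ _)
  obtain ⟨c, hc, N, hcN⟩ := exists_linear_copies_pathTree.{u} (k := k) (by omega) hC
  filter_upwards [h.eventually (gt_mem_nhds (div_pos hc hC)), hsize.eventually_ge_atTop N]
    with n h1 h2
  have hn := card_pos_of_isTree hT n
  refine (le_max_left b 1).trans ?_
  by_contra! hlt
  rw [one_div, inv_mul_lt_iff₀ hn, mul_comm] at hlt
  have h3 := hcN _ _ (hT n) h2 hlt.le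
  have h4 : (copies (pathTree k) (T n) : ℝ) ≤ subtreeCount k (T n) := by
    exact_mod_cast (Nat.le_add_right _ _).trans
      (copies_pathTree_add_copies_starTree_le (hT n).isAcyclic hk)
  have hZ : (0 : ℝ) < subtreeCount k (T n) := (mul_pos hc hn).trans_le (h3.trans h4)
  rw [pathProportion, div_lt_div_iff₀ hZ hC] at h1
  -- With `Z < C * n`, a path proportion below `c / C` would mean fewer than `c * n` paths.
  nlinarith

lemma M2.m4 (hT : ∀ n, (T n).IsTree) (hk : 3 ≤ k) (h : M2 k T) : M4 k T := by
  obtain ⟨a, ha, b, hb, hab⟩ := exists_degreePowerSum_le.{u} (k := k) (by omega)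
  refine Metric.tendsto_nhds.2 fun ε hε => ?_
  set A : ℝ := ((2 * k ^ (k - 3) : ℕ) : ℝ) with hA
  have hA0 : 0 ≤ A := Nat.cast_nonneg _
  -- This `M` bounds the power-sum part of the non-star proportion by `ε / 4`; the threshold on `Z /
  -- n` below does the same for the linear part.
  obtain ⟨M, hM⟩ := exists_nat_ge (4 * (A * a) / ε + 1)
  have hM1 : (1 : ℝ) ≤ M := le_trans (le_add_of_nonneg_left (by positivity)) hM
  obtain ⟨C, hC⟩ := exists_mul_nonStarCount_le.{u} k M hk (by exact_mod_cast hM1)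
  filter_upwards [tendsto_atTop.1 h (4 * (A * b + C) / ε + 1)] with n hn
  have hcard := card_pos_of_isTree hT n
  rw [one_div, le_inv_mul_iff₀ hcard] at hn
  have h1 := hab _ _ (hT n)
  have h2 : (M : ℝ) * nonStarCount k (T n) ≤
      A * degreePowerSum (k - 1) (T n) + C * Fintype.card (V n) := by
    rw [hA]
    exact_mod_cast hC _ _ (hT n)
  have h3 : (copies (starTree k) (T n) : ℝ) + nonStarCount k (T n) = subtreeCount k (T n) := by
    exact_mod_cast copies_starTree_add_nonStarCount (G := T n) (k := k) (by omega)
  have hN0 : (0 : ℝ) ≤ nonStarCount k (T n) := Nat.cast_nonneg _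
  rw [Real.dist_eq, starProportion]
  set Z : ℝ := (subtreeCount k (T n) : ℝ)
  set S : ℝ := (copies (starTree k) (T n) : ℝ)
  set N : ℝ := (nonStarCount k (T n) : ℝ)
  set m : ℝ := (Fintype.card (V n) : ℝ)
  have hZ : 0 < Z := lt_of_lt_of_le (by positivity) hn
  have h4 : M * N ≤ A * a * Z + (A * b + C) * m := by
    have h5 := mul_le_mul_of_nonneg_left h1 hA0
    have h6 : A * a * S ≤ A * a * Z := mul_le_mul_of_nonneg_left (by linarith) (by positivity)
    nlinarith
  have h5 : 4 * (A * a) ≤ ε * M := by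
    have : 4 * (A * a) / ε ≤ M := by linarith
    rwa [div_le_iff₀' hε] at this
  have h6 : 4 * ((A * b + C) * m) ≤ ε * Z := by
    have h7 : m * (4 * (A * b + C) / ε) ≤ Z := by nlinarith
    rw [mul_div_assoc', div_le_iff₀' hε] at h7
    linarith
  have h7 : M * N ≤ M * (ε / 2 * Z) := by
    have h8 : A * a * Z ≤ ε / 4 * M * Z := mul_le_mul_of_nonneg_right (by linarith) hZ.le
    have h9 : ε * Z ≤ M * (ε * Z) := le_mul_of_one_le_left (by positivity) hM1
    linarith
  have h8 := le_of_mul_le_mul_left h7 (by linarith)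
  have h9 : S / Z - 1 = -(N / Z) := by
    field_simp
    linarith
  rw [h9, abs_neg, abs_of_nonneg (by positivity), div_lt_iff₀ hZ]
  have := mul_pos hε hZ
  linarith

lemma M4.m1 (hT : ∀ n, (T n).IsTree) (hk : 4 ≤ k) (h : M4 k T) : M1 k T := by
  have h0 : Tendsto (fun n => 1 - starProportion k (T n)) atTop (𝓝 0) := by
    simpa using h.const_sub 1
  refine squeeze_zero (fun n => by unfold pathProportion; positivity) (fun n => ?_) h0
  rw [le_sub_iff_add_le, pathProportion, starProportion, ← add_div]
  refine div_le_one_of_le₀ ?_ (Nat.cast_nonneg _)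
  exact_mod_cast copies_pathTree_add_copies_starTree_le (hT n).isAcyclic hk

lemma M3.mono (hk : 2 ≤ k) (hkl : k ≤ l) (h : M3 k T) : M3 l T := by
  refine tendsto_atTop_mono (fun n => mul_le_mul_of_nonneg_left ?_ (by positivity)) h
  exact_mod_cast degreePowerSum_mono (by omega) (by omega)

lemma tfae_M (hT : ∀ n, (T n).IsTree)
    (hsize : Tendsto (fun n => Fintype.card (V n)) atTop atTop) (hk : 4 ≤ k) :
    List.TFAE [M1 k T, M2 k T, M3 k T, M4 k T] := by
  tfae_have 1 → 2 := M1.m2 hT hsize hk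
  tfae_have 2 → 3 := M2.m3 (by omega)
  tfae_have 3 → 2 := M3.m2 hT (by omega)
  tfae_have 2 → 4 := M2.m4 hT (by omega)
  tfae_have 4 → 1 := M4.m1 hT hk
  tfae_finish

end Limits

end TreeProfile

theorem mainTheorem3 {V : ℕ → Type*} [∀ n, Fintype (V n)] (T : ∀ n, SimpleGraph (V n))
    (hT : ∀ n, (T n).IsTree)
    (hsize : Tendsto (fun n => Fintype.card (V n)) atTop atTop)
    (k l : ℕ) (hk : 4 ≤ k) (hkl : k ≤ l) :
    List.TFAE [TreeProfile.M1 k T, TreeProfile.M2 k T, TreeProfile.M3 k T, TreeProfile.M4 k T] ∧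
    ((TreeProfile.M1 k T ∨ TreeProfile.M2 k T ∨ TreeProfile.M3 k T ∨ TreeProfile.M4 k T) →
      TreeProfile.M1 l T ∧ TreeProfile.M2 l T ∧ TreeProfile.M3 l T ∧ TreeProfile.M4 l T) := by
  have hk' := TreeProfile.tfae_M hT hsize hk
  have hl' := TreeProfile.tfae_M hT hsize (hk.trans hkl)
  refine ⟨hk', fun h => ?_⟩
  have h3 : TreeProfile.M3 k T := by
    rcases h with h | h | h | h
    · exact (hk'.out 0 2).1 h
    · exact (hk'.out 1 2).1 h
    · exact h
    · exact (hk'.out 3 2).1 h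
  have h3l := h3.mono (by omega) hkl
  exact ⟨(hl'.out 2 0).1 h3l, (hl'.out 2 1).1 h3l, h3l, (hl'.out 2 3).1 h3l⟩
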